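/- Let $d\in\{1,2,3,7,11\}$, let $K=\mathbb{Q}(\sqrt{-d})\subset\mathbb{C}$ with ring of integers $\mathcal{O}_d$, and let $N(b)=b\bar b=|b|^2$ be the norm. Let $\Delta$ be a positive integer that is not the norm of any element of $\mathcal{O}_d$. For an odd integer $k\ge 1$ and $z\in\mathbb{C}$ put $$H_{k,\Delta}(z)=\sum h(z)^k ,$$ where the sum runs over all integral binary Hermitian forms $h(z)=a|z|^2+bz+\bar b\bar z+c$ with $a,c\in\mathbb{Z}$, $b\in\mathcal{O}_d$, discriminant $ac-N(b)=-\Delta$, and $a<0<h(z)$. Then: 1. for every $z\in\mathbb{C}$ the series $H_{1,\Delta}(z)$ converges and $H_{1,\Delta}(z)=\alpha_{1,\Delta}$; 2. if $d\in\{1,3,7\}$, then for every $z\in\mathbb{C}$ the series $H_{3,\Delta}(z)$ converges and $H_{3,\Delta}(z)=\alpha_{3,\Delta}$; 3. if $d=3$, then for every $z\in\mathbb{C}$ the series $H_{5,\Delta}(z)$ converges and $H_{5,\Delta}(z)=\alpha_{5,\Delta}$. Here, for every odd $k\ge 1$, $$\alpha_{k,\Delta}=H_{k,\Delta}(0)=\sum_{\substack{b\in\mathcal{O}_d\\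 N(b)<\Delta}}\sigma_k(\Delta-N(b)),$$ a finite sum, where $\sigma_k(n)=\sum_{m\mid n}m^k$ is taken over the positive divisors $m$ of $n$. -/

import Mathlib

open NumberField

noncomputable section

namespace HermitianSums

/-- The imaginary quadratic field `ℚ(√-d)`, as a subfield of `ℂ`. -/
abbrev K (d : ℕ) : IntermediateField ℚ ℂ :=
  IntermediateField.adjoin ℚ {Complex.I * (Real.sqrt d : ℂ)}

/-- The inclusion of the ring of integers of `ℚ(√-d)` into `ℂ`. -/
def toC {d : ℕ} (b : 𝓞 (K d)) : ℂ := ((b : K d) : ℂ)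

/-- An integral binary Hermitian form, given by the Hermitian matrix `!![a, b; conj b, c]`
with `a, c ∈ ℤ` and `b` in the ring of integers of `ℚ(√-d)`. -/
structure HermForm (d : ℕ) where
  a : ℤ
  b : 𝓞 (K d)
  c : ℤ

namespace HermForm

/-- The discriminant `a c - N(b)`, where `N` is the norm of the ring of integers over `ℤ`. -/
def discr {d : ℕ} (h : HermForm d) : ℤ := h.a * h.c - Algebra.norm ℤ h.b

/-- The value `h(z) = a |z|² + b z + conj (b z) + c`, where `b z + conj (b z) = 2 Re (b z)`. -/
def eval {d : ℕ} (h : HermForm d) (z : ℂ) : ℝ :=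
  h.a * ‖z‖ ^ 2 + 2 * (toC h.b * z).re + h.c

/-- The Hermitian matrix of the form. -/
def matrix {d : ℕ} (h : HermForm d) : Matrix (Fin 2) (Fin 2) ℂ :=
  !![(h.a : ℂ), toC h.b; (starRingEnd ℂ) (toC h.b), (h.c : ℂ)]

end HermForm

/-- The set of integral forms `h` of discriminant `-Δ` with `a < 0 < h(z)`. -/
def forms (d Δ : ℕ) (z : ℂ) : Set (HermForm d) :=
  {h | h.discr = -(Δ : ℤ) ∧ h.a < 0 ∧ 0 < h.eval z}

/-- `H_{k,Δ}(z)`, the sum of `h(z)^k` over the forms `h` of discriminant `-Δ` with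
`a < 0 < h(z)`. -/
def H (d k Δ : ℕ) (z : ℂ) : ℝ := ∑' h : forms d Δ z, (h : HermForm d).eval z ^ k

/-- The value of the form is the value at `(z, 1)` of the Hermitian matrix. -/
theorem HermForm.eval_eq {d : ℕ} (h : HermForm d) (z : ℂ) :
    ((h.eval z : ℝ) : ℂ) = ![z, 1] ⬝ᵥ (h.matrix.mulVec ![(starRingEnd ℂ) z, 1]) := by
  apply Complex.ext
  · simp [HermForm.eval, HermForm.matrix, Matrix.mulVec, dotProduct, Fin.sum_univ_two,
      ← Complex.normSq_eq_norm_sq, Complex.normSq_apply]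
    ring
  · rw [Complex.ofReal_im]
    simp [HermForm.matrix, Matrix.mulVec, dotProduct, Fin.sum_univ_two]
    ring

/-- For `d > 0` the norm of an algebraic integer `b` of `ℚ(√-d)` is `|b|²`. -/
theorem norm_eq {d : ℕ} (hd : 0 < d) (b : 𝓞 (K d)) :
    ((Algebra.norm ℤ b : ℤ) : ℝ) = Complex.normSq (toC b) := by
  set r : ℂ := Complex.I * (Real.sqrt d : ℂ) with hr
  have hr2 : r ^ 2 = -(d : ℂ) := by
    rw [hr, mul_pow, Complex.I_sq, ← Complex.ofReal_pow, Real.sq_sqrt (by positivity)]; simp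
  have hint : IsIntegral ℚ r := by
    refine ⟨Polynomial.X ^ 2 + Polynomial.C (d : ℚ), by monicity!, ?_⟩
    simp [hr2]
  have hfd : FiniteDimensional ℚ (K d) := IntermediateField.adjoin.finiteDimensional hint
  have hnf : NumberField (K d) := ⟨⟩
  have hle : Module.finrank ℚ (K d) ≤ 2 := by
    rw [show Module.finrank ℚ (K d) = _ from IntermediateField.adjoin.finrank hint]
    have hm : (Polynomial.X ^ 2 + Polynomial.C (d : ℚ)).Monic := by monicity!
    have h2 : (Polynomial.X ^ 2 + Polynomial.C (d : ℚ)).natDegree = 2 := by compute_degree!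
    rw [← h2]
    exact Polynomial.natDegree_le_natDegree
      (minpoly.min ℚ r hm (by simp [hr2]))
  let i1 : K d →ₐ[ℚ] ℂ := (K d).val
  let i2 : K d →ₐ[ℚ] ℂ := (Complex.conjAe.toAlgHom.restrictScalars ℚ).comp (K d).val
  have hne : i1 ≠ i2 := by
    intro h
    have h1 := DFunLike.congr_fun h
      ⟨r, IntermediateField.mem_adjoin_simple_self ℚ r⟩
    have h3 : (starRingEnd ℂ) r = r := h1.symm
    have h4 : r.im = 0 := Complex.conj_eq_iff_im.mp h3
    have h5 : Real.sqrt d = 0 := by simpa [hr] using h4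
    have : (0 : ℝ) < Real.sqrt d := Real.sqrt_pos.mpr (by exact_mod_cast hd)
    linarith
  classical
  have huniv : (Finset.univ : Finset (K d →ₐ[ℚ] ℂ)) = {i1, i2} := by
    symm
    apply Finset.eq_univ_of_card
    apply le_antisymm (Finset.card_le_univ _)
    rw [Finset.card_pair hne, AlgHom.card]
    exact hle
  have h1 := Algebra.norm_eq_prod_embeddings ℚ ℂ (b : K d)
  rw [huniv, Finset.prod_pair hne, ← Algebra.coe_norm_int] at h1
  have h2 : i1 (b : K d) * i2 (b : K d) = (Complex.normSq (toC b) : ℂ) :=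
    Complex.mul_conj (toC b)
  rw [h2] at h1
  have h3 : (((Algebra.norm ℤ b : ℤ) : ℝ) : ℂ) = (Complex.normSq (toC b) : ℂ) := by
    simpa using h1
  exact_mod_cast h3

/-- For `d > 0` the discriminant of a form is the determinant of its matrix. -/
theorem HermForm.discr_eq {d : ℕ} (hd : 0 < d) (h : HermForm d) :
    (h.discr : ℂ) = h.matrix.det := by
  have h1 : ((Algebra.norm ℤ h.b : ℤ) : ℂ) = (Complex.normSq (toC h.b) : ℂ) := by
    exact_mod_cast congrArg (fun x : ℝ => (x : ℂ)) (norm_eq hd h.b)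
  rw [HermForm.discr, HermForm.matrix, Matrix.det_fin_two_of, Complex.mul_conj, ← h1]
  push_cast
  ring

end HermitianSums

end

/-! Let P be the `period`, the finite sum of h(z)^k over the forms with a < 0 < c. Integral
translations, z ↦ -z and conjugation permute the forms with a < 0, so they leave H invariant.
Inversion trades the condition a < 0 for c < 0. Since Δ is not a norm, a and c never vanish, and for
odd k the two sums differ exactly by P: H(z) = |z|^{2k} H(1/z) + P(z) (`hasSum_term_inv'`).

Suppose P = α(1 - |z|^{2k}) with α = H(0). The constant α then satisfies the same relations, and
Euclid's algorithm carries the value from 0 to all of ℚ(√-d). Density and continuity of the summands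
give H ≤ α on ℂ. The defect D = α - H satisfies D(w) = |w|^{2k} D(1/w), and w can be translated to
|w|² ≤ 15/16, so iteration forces D = 0 (`hasSum_term_of_period_eq`).

It remains to compute P. The symmetries of its index set give the required shape for k = 1, and for
k = 3 and k = 5 (d = 3) they leave two unknown coefficients p, q. Closed cycles of inversions and
translations at points of the field make H cancel and give linear relations for P
(`period_triangle`, `period_square`). Together with rotation by units these force p = q = 0. -/

noncomputable section

namespace HermitianSums

/-! ### Integers of ℚ(√-d): conjugation, finiteness, Euclidean approximation -/

section Integers

variable {d : ℕ}

@[simp] theorem toC_add (x y : 𝓞 (K d)) : toC (x + y) = toC x + toC y := rfl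
@[simp] theorem toC_sub (x y : 𝓞 (K d)) : toC (x - y) = toC x - toC y := rfl
@[simp] theorem toC_neg (x : 𝓞 (K d)) : toC (-x) = -toC x := rfl
@[simp] theorem toC_mul (x y : 𝓞 (K d)) : toC (x * y) = toC x * toC y := rfl
@[simp] theorem toC_one : toC (1 : 𝓞 (K d)) = 1 := rfl
@[simp] theorem toC_zero : toC (0 : 𝓞 (K d)) = 0 := rfl
@[simp] theorem toC_intCast (n : ℤ) : toC (n : 𝓞 (K d)) = n := by
  simp [toC]

theorem toC_injective : Function.Injective (toC (d := d)) := fun _ _ h =>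
  RingOfIntegers.ext (Subtype.ext h)

theorem toC_mem (b : 𝓞 (K d)) : toC b ∈ K d := (b : K d).2

theorem exists_toC_eq {z : ℂ} (hz : z ∈ K d) (hi : IsIntegral ℤ z) :
    ∃ b : 𝓞 (K d), toC b = z := by
  have h : IsIntegral ℤ (⟨z, hz⟩ : K d) := by
    rw [← isIntegral_algebraMap_iff (B := ℂ) (algebraMap (K d) ℂ).injective]
    exact hi
  exact ⟨⟨⟨z, hz⟩, h⟩, rfl⟩

theorem sqrt_sq (d : ℕ) : (Complex.I * (Real.sqrt d : ℂ)) ^ 2 = -(d : ℂ) := by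
  rw [mul_pow, Complex.I_sq, ← Complex.ofReal_pow, Real.sq_sqrt (by positivity)]
  simp

theorem sqrt_mem (d : ℕ) : Complex.I * (Real.sqrt d : ℂ) ∈ K d :=
  IntermediateField.mem_adjoin_simple_self ℚ _

theorem exists_toC_eq_sqrt (d : ℕ) :
    ∃ s : 𝓞 (K d), toC s = Complex.I * (Real.sqrt d : ℂ) := by
  refine exists_toC_eq (sqrt_mem d) ⟨Polynomial.X ^ 2 + Polynomial.C (d : ℤ), by monicity!, ?_⟩
  simp [sqrt_sq]

theorem exists_toC_eq_half {n : ℕ} (hn : d + 1 = 4 * n) :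
    ∃ s : 𝓞 (K d), toC s = (1 + Complex.I * (Real.sqrt d : ℂ)) / 2 := by
  refine exists_toC_eq (div_mem (add_mem (one_mem _) (sqrt_mem d)) (ofNat_mem _ 2))
    ⟨Polynomial.X ^ 2 - Polynomial.X + Polynomial.C (n : ℤ), by monicity!, ?_⟩
  have h := sqrt_sq d
  have hn' : (d : ℂ) + 1 = 4 * n := by exact_mod_cast hn
  simp
  linear_combination h / 4 - hn' / 4

theorem numberField (d : ℕ) : NumberField (K d) := by
  have hint : IsIntegral ℚ (Complex.I * (Real.sqrt d : ℂ)) := by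
    refine ⟨Polynomial.X ^ 2 + Polynomial.C (d : ℚ), by monicity!, ?_⟩
    simp [sqrt_sq]
  have := IntermediateField.adjoin.finiteDimensional hint
  exact ⟨⟩

theorem exists_eq_div {z : ℂ} (hz : z ∈ K d) :
    ∃ p q : 𝓞 (K d), q ≠ 0 ∧ z = toC p / toC q := by
  have := numberField d
  obtain ⟨p, q, hq, h⟩ := IsFractionRing.div_surjective (A := 𝓞 (K d)) (⟨z, hz⟩ : K d)
  exact ⟨p, q, nonZeroDivisors.ne_zero hq, (congrArg Subtype.val h).symm⟩

theorem norm_nonneg' (hd : 0 < d) (b : 𝓞 (K d)) : 0 ≤ Algebra.norm ℤ b := by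
  have h := norm_eq hd b
  have : (0 : ℝ) ≤ (Algebra.norm ℤ b : ℤ) := h ▸ Complex.normSq_nonneg _
  exact_mod_cast this

/-- The trace of an integer of an imaginary quadratic field, expressed through norms. -/
def tr (b : 𝓞 (K d)) : ℤ := Algebra.norm ℤ (b + 1) - Algebra.norm ℤ b - 1

theorem tr_eq (hd : 0 < d) (b : 𝓞 (K d)) : (tr b : ℝ) = 2 * (toC b).re := by
  simp only [tr, Int.cast_sub, norm_eq hd, Complex.normSq_apply, toC_add, toC_one]
  simp
  ring

/-- Complex conjugation on the ring of integers. -/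
def conjO (b : 𝓞 (K d)) : 𝓞 (K d) := (tr b : 𝓞 (K d)) - b

theorem toC_conjO (hd : 0 < d) (b : 𝓞 (K d)) : toC (conjO b) = (starRingEnd ℂ) (toC b) := by
  have h := tr_eq hd b
  apply Complex.ext
  · simp [conjO, h]; ring
  · simp [conjO]

theorem finite_norm_lt (hd : 0 < d) (n : ℤ) : {b : 𝓞 (K d) | Algebra.norm ℤ b < n}.Finite := by
  have := numberField d
  -- The bound |n| + 1 replaces √|n|: x² ≤ |n| implies x ≤ |n| + 1.
  have hd1 := (NumberField.Embeddings.finite_of_norm_le (K d) ℂ (|n| + 1))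
  refine Set.Finite.of_finite_image (f := fun b : 𝓞 (K d) => (b : K d)) (hd1.subset ?_)
    (fun _ _ _ _ h => RingOfIntegers.ext h)
  rintro _ ⟨b, hb, rfl⟩
  refine ⟨b.isIntegral_coe, fun φ => ?_⟩
  -- every embedding sends `b` to a root of `X² - tr b X + N b`
  have hroot : b * b - (tr b : 𝓞 (K d)) * b + (Algebra.norm ℤ b : 𝓞 (K d)) = 0 := by
    apply toC_injective
    have h1 := tr_eq hd b
    have h2 := norm_eq hd b
    rw [Complex.normSq_apply] at h2
    apply Complex.ext
    · simp [h1, h2]; ring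
    · simp [h1]; ring
  have h3 : φ b * φ b - (tr b : ℂ) * φ b + (Algebra.norm ℤ b : ℂ) = 0 := by
    have := congrArg (fun x : 𝓞 (K d) => φ x) hroot
    simpa using this
  have h4 : (φ b - toC b) * (φ b - (starRingEnd ℂ) (toC b)) = 0 := by
    have h1 : ((tr b : ℤ) : ℂ) = toC b + (starRingEnd ℂ) (toC b) := by
      rw [Complex.add_conj, ← tr_eq hd b]; simp
    have h2 : ((Algebra.norm ℤ b : ℤ) : ℂ) = toC b * (starRingEnd ℂ) (toC b) := by
      rw [Complex.mul_conj, ← norm_eq hd b]; simp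
    rw [h1, h2] at h3
    linear_combination h3
  have h5 : ‖φ b‖ = ‖toC b‖ := by
    rcases mul_eq_zero.mp h4 with h | h
    · rw [sub_eq_zero.mp h]
    · rw [sub_eq_zero.mp h, Complex.norm_conj]
  have h6 : ‖toC b‖ ^ 2 ≤ |(n : ℝ)| := by
    rw [← Complex.normSq_eq_norm_sq, ← norm_eq hd b]
    have : ((Algebra.norm ℤ b : ℤ) : ℝ) < n := by exact_mod_cast hb
    exact this.le.trans (le_abs_self _)
  rw [h5]
  push_cast
  nlinarith [norm_nonneg (toC b), abs_nonneg (n : ℝ)]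

/-- Round the imaginary coordinate and then the real one in ℤ[√-d] or ℤ[(1+√-d)/2]. The worst case
is d = 11, with 1/4 + 11/16 = 15/16. A uniform constant below 1 drives Euclid's algorithm and the
final contraction. -/
theorem exists_norm_sub_sq_le (hd : d = 1 ∨ d = 2 ∨ d = 3 ∨ d = 7 ∨ d = 11) (z : ℂ) :
    ∃ b : 𝓞 (K d), ‖z - toC b‖ ^ 2 ≤ 15 / 16 := by
  obtain ⟨s, hs⟩ := exists_toC_eq_sqrt d
  have hd0 : (0 : ℝ) < d := by rcases hd with rfl | rfl | rfl | rfl | rfl <;> norm_num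
  have hq : Real.sqrt d ^ 2 = d := Real.sq_sqrt hd0.le
  have hq0 : 0 < Real.sqrt d := Real.sqrt_pos.mpr hd0
  have sq_le : ∀ t : ℝ, |t| ≤ 1 / 2 → t ^ 2 ≤ 1 / 4 := fun t ht => by
    have := abs_le.mp ht
    nlinarith
  simp only [← Complex.normSq_eq_norm_sq, Complex.normSq_apply, ← sq]
  by_cases h2 : d ≤ 2
  · have hd2 : (d : ℝ) ≤ 2 := by exact_mod_cast h2
    obtain ⟨y, hy⟩ : ∃ y : ℤ, |z.im / Real.sqrt d - y| ≤ 1 / 2 := ⟨_, abs_sub_round _⟩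
    obtain ⟨x, hx⟩ : ∃ x : ℤ, |z.re - x| ≤ 1 / 2 := ⟨_, abs_sub_round _⟩
    refine ⟨x + y * s, ?_⟩
    have h1 := sq_le _ hx
    have h3 := sq_le _ hy
    have h4 : (z.im - y * Real.sqrt d) ^ 2 = d * (z.im / Real.sqrt d - y) ^ 2 := by
      nth_rewrite 2 [← hq]; field_simp
    have h5 : (z - toC ((x : 𝓞 (K d)) + (y : 𝓞 (K d)) * s)).re = z.re - x := by simp [hs]
    have h6 : (z - toC ((x : 𝓞 (K d)) + (y : 𝓞 (K d)) * s)).im = z.im - y * Real.sqrt d := by simp [hs]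
    rw [h5, h6, h4]
    nlinarith
  · have hn : ∃ n, d + 1 = 4 * n := by
      rcases hd with rfl | rfl | rfl | rfl | rfl
      · omega
      · omega
      · exact ⟨1, rfl⟩
      · exact ⟨2, rfl⟩
      · exact ⟨3, rfl⟩
    have hd11 : (d : ℝ) ≤ 11 := by
      have : d ≤ 11 := by omega
      exact_mod_cast this
    obtain ⟨n, hn⟩ := hn
    obtain ⟨t, ht⟩ := exists_toC_eq_half hn
    obtain ⟨y, hy⟩ : ∃ y : ℤ, |z.im / (Real.sqrt d / 2) - y| ≤ 1 / 2 := ⟨_, abs_sub_round _⟩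
    obtain ⟨x, hx⟩ : ∃ x : ℤ, |z.re - y / 2 - x| ≤ 1 / 2 := ⟨_, abs_sub_round _⟩
    refine ⟨x + y * t, ?_⟩
    have h1 := sq_le _ hx
    have h3 := sq_le _ hy
    have h4 : (z.im - y * (Real.sqrt d / 2)) ^ 2 = d / 4 * (z.im / (Real.sqrt d / 2) - y) ^ 2 := by
      nth_rewrite 2 [← hq]; field_simp; ring
    have h5 : (z - toC ((x : 𝓞 (K d)) + (y : 𝓞 (K d)) * t)).re = z.re - y / 2 - x := by simp [ht]; ring
    have h6 : (z - toC ((x : 𝓞 (K d)) + (y : 𝓞 (K d)) * t)).im = z.im - y * (Real.sqrt d / 2) := by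
      simp [ht]
    rw [h5, h6, h4]
    nlinarith

/-- Approximating nz by an integer of the field and dividing by n leaves an error below 1/n. -/
theorem dense_K (hd : d = 1 ∨ d = 2 ∨ d = 3 ∨ d = 7 ∨ d = 11) : Dense (K d : Set ℂ) := by
  intro z
  rw [Metric.mem_closure_iff]
  intro ε hε
  obtain ⟨n, hn⟩ := exists_nat_gt (1 / ε)
  have hn0 : (0 : ℝ) < n := lt_trans (by positivity) hn
  obtain ⟨b, hb⟩ := exists_norm_sub_sq_le hd (n * z)
  refine ⟨toC b / n, div_mem (toC_mem b) (natCast_mem _ n), ?_⟩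
  have h1 : z - toC b / n = (n * z - toC b) / n := by
    have : (n : ℂ) ≠ 0 := by exact_mod_cast hn0.ne'
    field_simp
  rw [dist_eq_norm, h1, norm_div, Complex.norm_natCast, div_lt_iff₀ hn0]
  rw [div_lt_iff₀ hε] at hn
  have : ‖n * z - toC b‖ < 1 := by nlinarith [norm_nonneg (n * z - toC b)]
  linarith

end Integers

/-! ### Actions on forms and the transformation laws of H -/

section Forms

variable {d : ℕ}

namespace HermForm

theorem ext_coe {h h' : HermForm d} (ha : h.a = h'.a) (hb : toC h.b = toC h'.b)
    (hc : h.c = h'.c) : h = h' := by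
  cases h; cases h'
  simp only [mk.injEq] at *
  exact ⟨ha, toC_injective hb, hc⟩

/-- The values at 0, 1, -1, i already determine the coefficients. Maps of forms can thus be shown
mutually inverse through their action on z. -/
theorem ext_eval {h h' : HermForm d} (H : ∀ z, h.eval z = h'.eval z) : h = h' := by
  have h0 := H 0
  have h1 := H 1
  have h2 := H (-1)
  have h3 := H Complex.I
  simp [eval] at h0 h1 h2 h3
  refine ext_coe ?_ (Complex.ext ?_ ?_) h0
  · have : (h.a : ℝ) = h'.a := by rw [h0] at h1 h2; linarith
    exact_mod_cast this
  · linarith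
  · rw [h0] at h1 h2 h3; linarith

theorem discr_real (hd : 0 < d) (h : HermForm d) :
    (h.discr : ℝ) = h.a * h.c - Complex.normSq (toC h.b) := by
  rw [discr, Int.cast_sub, Int.cast_mul, norm_eq hd]

/-- The form `h(z + β)`. -/
def translate (β : 𝓞 (K d)) (h : HermForm d) : HermForm d :=
  ⟨h.a, h.b + h.a * conjO β, h.a * Algebra.norm ℤ β + tr (h.b * β) + h.c⟩

theorem eval_translate (hd : 0 < d) (β : 𝓞 (K d)) (h : HermForm d) (z : ℂ) :
    (translate β h).eval z = h.eval (z + toC β) := by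
  simp only [eval, translate, ← Complex.normSq_eq_norm_sq, Int.cast_add, Int.cast_mul,
    norm_eq hd, tr_eq hd, toC_add, toC_mul, toC_conjO hd, Complex.normSq_apply, toC_intCast]
  simp
  ring

theorem discr_translate (hd : 0 < d) (β : 𝓞 (K d)) (h : HermForm d) :
    (translate β h).discr = h.discr := by
  have : ((translate β h).discr : ℝ) = h.discr := by
    simp only [discr_real hd, translate, Int.cast_add, Int.cast_mul,
      norm_eq hd, tr_eq hd, toC_add, toC_mul, toC_conjO hd, Complex.normSq_apply, toC_intCast]
    simp
    ring
  exact_mod_cast this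

/-- The form `h(ε z)` for a unit `ε`. -/
def rotate (ε : 𝓞 (K d)) (h : HermForm d) : HermForm d := ⟨h.a, h.b * ε, h.c⟩

theorem eval_rotate {ε : 𝓞 (K d)} (hε : Complex.normSq (toC ε) = 1)
    (h : HermForm d) (z : ℂ) : (rotate ε h).eval z = h.eval (toC ε * z) := by
  simp only [eval, rotate, ← Complex.normSq_eq_norm_sq, toC_mul, map_mul, hε]
  ring_nf

theorem discr_rotate (hd : 0 < d) {ε : 𝓞 (K d)} (hε : Complex.normSq (toC ε) = 1)
    (h : HermForm d) : (rotate ε h).discr = h.discr := by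
  have : ((rotate ε h).discr : ℝ) = h.discr := by
    simp [discr_real hd, rotate, hε]
  exact_mod_cast this

/-- The form `h(conj z)`. -/
def conj (h : HermForm d) : HermForm d := ⟨h.a, conjO h.b, h.c⟩

theorem eval_conj (hd : 0 < d) (h : HermForm d) (z : ℂ) :
    (conj h).eval z = h.eval ((starRingEnd ℂ) z) := by
  simp [eval, conj, toC_conjO hd]

theorem discr_conj (hd : 0 < d) (h : HermForm d) : (conj h).discr = h.discr := by
  have : ((conj h).discr : ℝ) = h.discr := by
    simp [discr_real hd, conj, toC_conjO hd, Complex.normSq_conj]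
  exact_mod_cast this

/-- The form `|z|² h(1 / conj z)`. -/
def swap (h : HermForm d) : HermForm d := ⟨h.c, h.b, h.a⟩

theorem swap_swap (h : HermForm d) : swap (swap h) = h := rfl

theorem discr_swap (h : HermForm d) : (swap h).discr = h.discr := by
  simp [discr, swap, mul_comm]

theorem eval_swap (h : HermForm d) {z : ℂ} (hz : z ≠ 0) :
    ‖z‖ ^ 2 * (swap h).eval ((starRingEnd ℂ) z)⁻¹ = h.eval z := by
  have h1 : ((starRingEnd ℂ) z)⁻¹ = z * ((‖z‖ ^ 2)⁻¹ : ℝ) := by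
    rw [Complex.inv_def, Complex.conj_conj, Complex.normSq_conj, Complex.normSq_eq_norm_sq]
  have h2 : ‖z‖ ≠ 0 := norm_ne_zero_iff.mpr hz
  have h3 : (toC h.b * (z * ((‖z‖ ^ 2)⁻¹ : ℝ))).re = (toC h.b * z).re * (‖z‖ ^ 2)⁻¹ := by
    rw [← mul_assoc, Complex.re_mul_ofReal]
  simp only [eval, swap, norm_inv, Complex.norm_conj]
  rw [h1, h3]
  field_simp
  ring

/-- The form `-h`. -/
def neg (h : HermForm d) : HermForm d := ⟨-h.a, -h.b, -h.c⟩

theorem neg_neg' (h : HermForm d) : neg (neg h) = h := by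
  simp [neg]

theorem eval_neg (h : HermForm d) (z : ℂ) : (neg h).eval z = -h.eval z := by
  simp [eval, neg]; ring

theorem discr_neg (hd : 0 < d) (h : HermForm d) : (neg h).discr = h.discr := by
  have : ((neg h).discr : ℝ) = h.discr := by simp [discr_real hd, neg]
  exact_mod_cast this

theorem continuous_eval (h : HermForm d) : Continuous h.eval := by
  unfold eval
  fun_prop

end HermForm

open HermForm

/-- The summand of `H_{k,Δ}(z)`, extended by zero to all forms. -/
def term (k Δ : ℕ) (z : ℂ) (h : HermForm d) : ℝ :=
  if h.discr = -(Δ : ℤ) ∧ h.a < 0 then max (h.eval z) 0 ^ k else 0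

theorem term_nonneg (k Δ : ℕ) (z : ℂ) (h : HermForm d) : 0 ≤ term k Δ z h := by
  unfold term; split_ifs <;> positivity

/-- Truncating by `max` keeps each summand continuous although the index set jumps with z. Bounds on
finite partial sums therefore extend from a dense set. -/
theorem continuous_term (k Δ : ℕ) (h : HermForm d) : Continuous fun z => term k Δ z h := by
  unfold term
  have := h.continuous_eval
  split_ifs <;> fun_prop

theorem indicator_forms {k : ℕ} (hk : k ≠ 0) (Δ : ℕ) (z : ℂ) :
    (forms d Δ z).indicator (fun h => h.eval z ^ k) = term k Δ z := by
  ext h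
  by_cases h1 : h.discr = -(Δ : ℤ) ∧ h.a < 0
  · by_cases h2 : 0 < h.eval z
    · rw [Set.indicator_of_mem (show h ∈ forms d Δ z from ⟨h1.1, h1.2, h2⟩), term, if_pos h1,
        max_eq_left h2.le]
    · rw [Set.indicator_of_notMem (fun h3 : h ∈ forms d Δ z => h2 h3.2.2), term, if_pos h1,
        max_eq_right (not_lt.mp h2), zero_pow hk]
  · rw [Set.indicator_of_notMem (fun h3 : h ∈ forms d Δ z => h1 ⟨h3.1, h3.2.1⟩), term, if_neg h1]

theorem H_eq_tsum {k : ℕ} (hk : k ≠ 0) (Δ : ℕ) (z : ℂ) :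
    H d k Δ z = ∑' h : HermForm d, term k Δ z h := by
  rw [H, tsum_subtype (forms d Δ z) (fun h => h.eval z ^ k), indicator_forms hk]

theorem summable_forms_iff {k : ℕ} (hk : k ≠ 0) (Δ : ℕ) (z : ℂ) :
    Summable (fun h : forms d Δ z => (h : HermForm d).eval z ^ k) ↔
      Summable (term (d := d) k Δ z) := by
  rw [← indicator_forms hk]
  exact summable_subtype_iff_indicator (f := fun h : HermForm d => h.eval z ^ k)

/-- Reindexing along a bijection of forms that preserves a and the discriminant. Using `HasSum`
transports convergence and value together. -/
theorem hasSum_term_congr {f g : HermForm d → HermForm d} {φ ψ : ℂ → ℂ}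
    (ha : ∀ h, (f h).a = h.a) (hdisc : ∀ h, (f h).discr = h.discr)
    (hf : ∀ h z, (f h).eval z = h.eval (φ z)) (hg : ∀ h z, (g h).eval z = h.eval (ψ z))
    (h1 : ∀ z, φ (ψ z) = z) (h2 : ∀ z, ψ (φ z) = z) {k Δ : ℕ} {z : ℂ} {x : ℝ} :
    HasSum (term (d := d) k Δ (φ z)) x ↔ HasSum (term (d := d) k Δ z) x := by
  let e : HermForm d ≃ HermForm d :=
    ⟨f, g, fun h => ext_eval fun z => by rw [hg, hf, h1],
      fun h => ext_eval fun z => by rw [hf, hg, h2]⟩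
  rw [← e.hasSum_iff (f := term k Δ z)]
  have : term k Δ z ∘ e = term (d := d) k Δ (φ z) := by
    ext h
    simp only [Function.comp, term, e, Equiv.coe_fn_mk, ha, hdisc, hf]
  rw [this]

theorem hasSum_term_add (hd : 0 < d) (β : 𝓞 (K d)) {k Δ : ℕ} {z : ℂ} {x : ℝ} :
    HasSum (term (d := d) k Δ (z + toC β)) x ↔ HasSum (term (d := d) k Δ z) x :=
  hasSum_term_congr (f := translate β) (g := translate (-β)) (φ := fun z => z + toC β)
    (ψ := fun z => z - toC β) (fun _ => rfl) (discr_translate hd β) (eval_translate hd β)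
    (fun h z => by rw [eval_translate hd, toC_neg, sub_eq_add_neg]) (fun z => by ring)
    (fun z => by ring)

theorem hasSum_term_conj (hd : 0 < d) {k Δ : ℕ} {z : ℂ} {x : ℝ} :
    HasSum (term (d := d) k Δ ((starRingEnd ℂ) z)) x ↔ HasSum (term (d := d) k Δ z) x :=
  hasSum_term_congr (f := conj) (g := conj) (φ := starRingEnd ℂ) (ψ := starRingEnd ℂ)
    (fun _ => rfl) (discr_conj hd) (eval_conj hd) (eval_conj hd) Complex.conj_conj
    Complex.conj_conj

theorem hasSum_term_neg (hd : 0 < d) {k Δ : ℕ} {z : ℂ} {x : ℝ} :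
    HasSum (term (d := d) k Δ (-z)) x ↔ HasSum (term (d := d) k Δ z) x := by
  have hε : Complex.normSq (toC (-1 : 𝓞 (K d))) = 1 := by simp
  have := fun h z => eval_rotate (d := d) hε h z
  simp only [toC_neg, toC_one, neg_one_mul] at this
  exact hasSum_term_congr (f := rotate (-1)) (g := rotate (-1)) (φ := fun z => -z)
    (ψ := fun z => -z) (fun _ => rfl) (discr_rotate hd hε) this this neg_neg neg_neg

/-- Here N(b) + |a|c = Δ with |a|, c ≥ 1, which bounds all three coefficients. -/
theorem finite_edge (hd : 0 < d) (Δ : ℕ) :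
    {h : HermForm d | h.discr = -(Δ : ℤ) ∧ h.a < 0 ∧ 0 < h.c}.Finite := by
  refine (((Set.finite_Icc (-(Δ : ℤ)) 0).prod
    ((finite_norm_lt hd Δ).prod (Set.finite_Icc 0 (Δ : ℤ)))).image
    fun t : ℤ × 𝓞 (K d) × ℤ => HermForm.mk t.1 t.2.1 t.2.2).subset ?_
  rintro h ⟨h1, h2, h3⟩
  have h4 := norm_nonneg' hd h.b
  rw [HermForm.discr] at h1
  refine ⟨(h.a, h.b, h.c), ⟨⟨?_, h2.le⟩, ?_, h3.le, ?_⟩, rfl⟩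
  · change -(Δ : ℤ) ≤ h.a
    nlinarith
  · change Algebra.norm ℤ h.b < (Δ : ℤ)
    nlinarith
  · change h.c ≤ Δ
    nlinarith

/-- The forms of discriminant `-Δ` that separate the cusps `∞` and `0`, i.e. with `a < 0 < c`. -/
def edge (hd : 0 < d) (Δ : ℕ) : Finset (HermForm d) := (finite_edge hd Δ).toFinset

@[simp] theorem mem_edge (hd : 0 < d) {Δ : ℕ} {h : HermForm d} :
    h ∈ edge hd Δ ↔ h.discr = -(Δ : ℤ) ∧ h.a < 0 ∧ 0 < h.c := by
  simp [edge]

/-- The period function of `H_{k,Δ}` with respect to the inversion `z ↦ 1 / conj z`. -/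
def period (hd : 0 < d) (k Δ : ℕ) (z : ℂ) : ℝ := ∑ h ∈ edge hd Δ, h.eval z ^ k

theorem ac_ne_zero {Δ : ℕ} (hnorm : ¬ ∃ b : 𝓞 (K d), Algebra.norm ℤ b = (Δ : ℤ))
    {h : HermForm d} (hh : h.discr = -(Δ : ℤ)) : h.a ≠ 0 ∧ h.c ≠ 0 := by
  rw [HermForm.discr] at hh
  constructor <;> intro h0 <;> exact hnorm ⟨h.b, by rw [h0] at hh; linarith⟩

theorem pow_eq_max_sub_max {k : ℕ} (hk : Odd k) (x : ℝ) :
    x ^ k = max x 0 ^ k - max (-x) 0 ^ k := by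
  have h0 : k ≠ 0 := hk.pos.ne'
  rcases le_total 0 x with h | h
  · rw [max_eq_left h, max_eq_right (by linarith), zero_pow h0, sub_zero]
  · rw [max_eq_right h, max_eq_left (by linarith), zero_pow h0, hk.neg_pow]
    ring

/-- After `swap`, the scaled sum at 1/conj z runs over c < 0 instead of a < 0. Forms with both signs
negative cancel. Those with a < 0 < c remain with a plus sign, those with c < 0 < a with a minus
sign. Negating the latter and using that k is odd merges both into h(z)^k over `edge`. -/
theorem hasSum_term_inv (hd : 0 < d) {k Δ : ℕ} (hk : Odd k)
    (hnorm : ¬ ∃ b : 𝓞 (K d), Algebra.norm ℤ b = (Δ : ℤ)) {z : ℂ} (hz : z ≠ 0) {x : ℝ}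
    (hx : HasSum (term (d := d) k Δ ((starRingEnd ℂ) z)⁻¹) x) :
    HasSum (term (d := d) k Δ z) ((‖z‖ ^ 2) ^ k * x + period hd k Δ z) := by
  let eS : HermForm d ≃ HermForm d := ⟨swap, swap, swap_swap, swap_swap⟩
  let eN : HermForm d ≃ HermForm d := ⟨neg, neg, neg_neg', neg_neg'⟩
  let f (s : ℝ) (h : HermForm d) : ℝ :=
    if h.discr = -(Δ : ℤ) ∧ h.a < 0 ∧ 0 < h.c then max (s * h.eval z) 0 ^ k else 0
  have hf (s : ℝ) : HasSum (f s) (∑ h ∈ edge hd Δ, max (s * h.eval z) 0 ^ k) := by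
    rw [Finset.sum_congr rfl fun h hh => (if_pos ((mem_edge hd).mp hh)).symm]
    exact hasSum_sum_of_ne_finset_zero fun h hh => if_neg (mt (mem_edge hd).mpr hh)
  have h1 := ((eS.hasSum_iff.mpr hx).mul_left ((‖z‖ ^ 2) ^ k)).add
    ((hf 1).sub (eN.hasSum_iff.mpr (hf (-1))))
  have hP : period hd k Δ z = ∑ h ∈ edge hd Δ, max (1 * h.eval z) 0 ^ k
      - ∑ h ∈ edge hd Δ, max (-1 * h.eval z) 0 ^ k := by
    rw [period, ← Finset.sum_sub_distrib]
    exact Finset.sum_congr rfl fun h _ => by rw [pow_eq_max_sub_max hk, one_mul, neg_one_mul]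
  rw [← hP] at h1
  refine (congrArg (HasSum · _) (funext fun h => ?_)).mpr h1
  have hS : (‖z‖ ^ 2) ^ k * max ((swap h).eval ((starRingEnd ℂ) z)⁻¹) 0 ^ k
      = max (h.eval z) 0 ^ k := by
    rw [← mul_pow, mul_max_of_nonneg _ _ (by positivity), eval_swap h hz, mul_zero]
  simp only [Function.comp, term, f, eS, eN, Equiv.coe_fn_mk, discr_swap,
    discr_neg hd, eval_neg, mul_ite, hS, mul_zero, one_mul, neg_mul, neg_neg]
  -- As a and c are nonzero, only the four sign patterns need checking.
  by_cases hD : h.discr = -(Δ : ℤ)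
  · obtain ⟨ha, hc⟩ := ac_ne_zero hnorm hD
    simp only [hD, true_and, neg, swap, neg_lt_zero, neg_pos]
    rcases ha.lt_or_gt with ha | ha <;> rcases hc.lt_or_gt with hc | hc <;>
      simp [ha, hc, ha.not_gt, hc.not_gt]
  · simp [hD]

/-- Since h(0) = c, only the finitely many forms in `edge` contribute. -/
theorem hasSum_term_zero (hd : 0 < d) {k : ℕ} (hk : k ≠ 0) (Δ : ℕ) :
    HasSum (term (d := d) k Δ 0) (∑ h ∈ edge hd Δ, (h.c : ℝ) ^ k) := by
  have h0 : ∀ h : HermForm d, h.eval 0 = h.c := fun h => by simp [eval]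
  rw [Finset.sum_congr rfl (g := term k Δ 0)]
  · refine hasSum_sum_of_ne_finset_zero fun h hh => ?_
    rw [mem_edge] at hh
    unfold term
    split_ifs with h1
    · have : h.c ≤ 0 := not_lt.mp fun h3 => hh ⟨h1.1, h1.2, h3⟩
      have : (h.c : ℝ) ≤ 0 := by exact_mod_cast this
      rw [h0, max_eq_right this, zero_pow hk]
    · rfl
  · intro h hh
    rw [mem_edge] at hh
    have : (0 : ℝ) ≤ h.c := by exact_mod_cast hh.2.2.le
    rw [term, if_pos ⟨hh.1, hh.2.1⟩, h0, max_eq_left this]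

end Forms

/-! ### From the period function to constancy of H -/

section Reduction

variable {d : ℕ}

theorem pos_of_mem (hd : d = 1 ∨ d = 2 ∨ d = 3 ∨ d = 7 ∨ d = 11) : 0 < d := by omega

/-- Euclid's algorithm: every point of `ℚ(√-d)` is obtained from `0` by integral translations and
inversions. -/
theorem euclid_induction (hd : d = 1 ∨ d = 2 ∨ d = 3 ∨ d = 7 ∨ d = 11) {M : ℂ → Prop}
    (h0 : M 0) (hadd : ∀ (β : 𝓞 (K d)) (z : ℂ), M z → M (z + toC β))
    (hinv : ∀ z : ℂ, z ≠ 0 → M z⁻¹ → M z) {z : ℂ} (hz : z ∈ K d) : M z := by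
  have hd0 := pos_of_mem hd
  -- Induction on the norm of the denominator: p/q = r/q + β, and inverting r/q leaves the
  -- denominator r, of smaller norm.
  suffices H : ∀ (n : ℕ) (p q : 𝓞 (K d)), q ≠ 0 → Algebra.norm ℤ q < n → M (toC p / toC q) by
    obtain ⟨p, q, hq, rfl⟩ := exists_eq_div hz
    exact H ((Algebra.norm ℤ q).toNat + 1) p q hq (by omega)
  intro n
  induction n with
  | zero => intro p q _ hn; exact absurd (norm_nonneg' hd0 q) (by push_cast at hn; omega)
  | succ n ih =>
    intro p q hq hn
    have hq' : toC q ≠ 0 := fun h => hq (toC_injective h)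
    obtain ⟨β, hβ⟩ := exists_norm_sub_sq_le hd (toC p / toC q)
    have h1 : toC p / toC q = toC (p - β * q) / toC q + toC β := by
      simp only [toC_sub, toC_mul]; field_simp; ring
    rw [h1]
    apply hadd
    by_cases hr : p - β * q = 0
    · simpa [hr] using h0
    have hr' : toC (p - β * q) ≠ 0 := fun h => hr (toC_injective h)
    refine hinv _ (div_ne_zero hr' hq') ?_
    rw [inv_div]
    refine ih q _ hr ?_
    have h2 : toC p / toC q - toC β = toC (p - β * q) / toC q := by rw [h1]; ring
    have hq2 : 0 < ‖toC q‖ ^ 2 := by positivity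
    rw [h2, norm_div, div_pow, div_le_iff₀ hq2] at hβ
    have h3 : ((Algebra.norm ℤ (p - β * q) : ℤ) : ℝ) < (Algebra.norm ℤ q : ℤ) := by
      rw [norm_eq hd0, norm_eq hd0, Complex.normSq_eq_norm_sq, Complex.normSq_eq_norm_sq]
      linarith
    have h4 : Algebra.norm ℤ (p - β * q) < Algebra.norm ℤ q := by exact_mod_cast h3
    push_cast at hn
    omega

/-- Conjugation invariance replaces 1/conj z by 1/z, so the later relations involve only Möbius
maps. -/
theorem hasSum_term_inv' (hd : 0 < d) {k Δ : ℕ} (hk : Odd k)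
    (hnorm : ¬ ∃ b : 𝓞 (K d), Algebra.norm ℤ b = (Δ : ℤ)) {z : ℂ} (hz : z ≠ 0) {x : ℝ}
    (hx : HasSum (term (d := d) k Δ z⁻¹) x) :
    HasSum (term (d := d) k Δ z) ((‖z‖ ^ 2) ^ k * x + period hd k Δ z) := by
  refine hasSum_term_inv hd hk hnorm hz ?_
  rwa [← map_inv₀, hasSum_term_conj hd]

/-- Nothing is assumed about the period here: convergence on the field comes first, since the
relations that determine the period are evaluated there. -/
theorem summable_term_of_mem (hd : d = 1 ∨ d = 2 ∨ d = 3 ∨ d = 7 ∨ d = 11) {k Δ : ℕ} (hk : Odd k)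
    (hnorm : ¬ ∃ b : 𝓞 (K d), Algebra.norm ℤ b = (Δ : ℤ)) {z : ℂ} (hz : z ∈ K d) :
    Summable (term (d := d) k Δ z) := by
  have hd0 := pos_of_mem hd
  exact euclid_induction hd (M := fun z => Summable (term (d := d) k Δ z))
    (hasSum_term_zero hd0 hk.pos.ne' Δ).summable
    (fun β z h => ((hasSum_term_add hd0 β).mpr h.hasSum).summable)
    (fun z hz h => (hasSum_term_inv' hd0 hk hnorm hz h.hasSum).summable) hz

/-- If the period function is a multiple of `1 - |z|^{2k}`, then `H_{k,Δ}` is constant. -/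
theorem hasSum_term_of_period_eq (hd : d = 1 ∨ d = 2 ∨ d = 3 ∨ d = 7 ∨ d = 11) {k Δ : ℕ}
    (hk : Odd k) (hnorm : ¬ ∃ b : 𝓞 (K d), Algebra.norm ℤ b = (Δ : ℤ))
    (hP : ∀ z, period (pos_of_mem hd) k Δ z
      = (∑ h ∈ edge (pos_of_mem hd) Δ, (h.c : ℝ) ^ k) * (1 - (‖z‖ ^ 2) ^ k)) (z : ℂ) :
    HasSum (term (d := d) k Δ z) (∑ h ∈ edge (pos_of_mem hd) Δ, (h.c : ℝ) ^ k) := by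
  have hd0 := pos_of_mem hd
  have h0 := hasSum_term_zero hd0 hk.pos.ne' Δ
  set α := ∑ h ∈ edge hd0 Δ, (h.c : ℝ) ^ k
  have hα : 0 ≤ α := h0.nonneg (term_nonneg k Δ 0)
  have hK : ∀ z ∈ K d, HasSum (term (d := d) k Δ z) α := fun z hz =>
    euclid_induction hd (M := fun z => HasSum (term (d := d) k Δ z) α) h0
      (fun β z h => (hasSum_term_add hd0 β).mpr h)
      (fun z hz h => by
        have := hasSum_term_inv' hd0 hk hnorm hz h
        rwa [hP, show (‖z‖ ^ 2) ^ k * α + α * (1 - (‖z‖ ^ 2) ^ k) = α by ring] at this) hz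
  -- Each finite partial sum is continuous and at most α on the dense field, hence at most α
  -- everywhere.
  have hfin (S : Finset (HermForm d)) (z : ℂ) : ∑ h ∈ S, term k Δ z h ≤ α := by
    have hc : IsClosed {z : ℂ | ∑ h ∈ S, term k Δ z h ≤ α} :=
      isClosed_le (continuous_finsetSum _ fun h _ => continuous_term k Δ h) continuous_const
    exact hc.closure_subset_iff.mpr
      (fun w hw => sum_le_hasSum S (fun h _ => term_nonneg k Δ w h) (hK w hw)) (dense_K hd z)
  have hsum (z : ℂ) : Summable (term (d := d) k Δ z) :=
    summable_of_sum_le (term_nonneg k Δ z) fun S => hfin S z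
  have hle (z : ℂ) : ∑' h : HermForm d, term k Δ z h ≤ α := (hsum z).tsum_le_of_sum_le fun S => hfin S z
  -- Each step translates z to w with |w|² ≤ 15/16; passing to 1/w then gains a factor |w|^{2k} ≤
  -- |w|².
  have hdecay (n : ℕ) : ∀ z : ℂ, α - ∑' h : HermForm d, term k Δ z h ≤ α * (15 / 16 : ℝ) ^ n := by
    induction n with
    | zero =>
      intro z
      have : 0 ≤ ∑' h : HermForm d, term k Δ z h := tsum_nonneg (term_nonneg k Δ z)
      simpa using this
    | succ n ih =>
      intro z
      obtain ⟨β, hβ⟩ := exists_norm_sub_sq_le hd z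
      have hz : ∑' h : HermForm d, term k Δ z h = ∑' h : HermForm d, term k Δ (z - toC β) h := by
        have := (hasSum_term_add hd0 β).mpr (hsum (z - toC β)).hasSum
        rw [sub_add_cancel] at this
        exact this.tsum_eq
      rw [hz]
      generalize z - toC β = w at hβ
      by_cases hw : w = 0
      · rw [hw, h0.tsum_eq, sub_self]
        positivity
      have h1 := (hasSum_term_inv' hd0 hk hnorm hw (hsum w⁻¹).hasSum).tsum_eq
      rw [h1, hP]
      have h2 : (‖w‖ ^ 2) ^ k ≤ 15 / 16 :=
        (pow_le_of_le_one (by positivity) (by linarith) hk.pos.ne').trans hβ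
      have h3 := ih w⁻¹
      have h4 := hle w⁻¹
      calc _ = (‖w‖ ^ 2) ^ k * (α - ∑' h : HermForm d, term k Δ w⁻¹ h) := by ring
        _ ≤ 15 / 16 * (α - ∑' h : HermForm d, term k Δ w⁻¹ h) :=
          mul_le_mul_of_nonneg_right h2 (by linarith)
        _ ≤ 15 / 16 * (α * (15 / 16 : ℝ) ^ n) := by linarith
        _ = _ := by ring
  have hge : α ≤ ∑' h : HermForm d, term k Δ z h := by
    have hlim : Filter.Tendsto (fun n : ℕ => α * (15 / 16 : ℝ) ^ n) Filter.atTop (nhds (α * 0)) :=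
      (tendsto_pow_atTop_nhds_zero_of_lt_one (by norm_num) (by norm_num)).const_mul α
    have := ge_of_tendsto' hlim fun n => hdecay n z
    linarith
  exact le_antisymm (hle z) hge ▸ (hsum z).hasSum

end Reduction

/-! ### Shape of the period function from symmetries -/

section Period

variable {d : ℕ}

open HermForm

theorem norm_sq_eq_re_im (z : ℂ) : ‖z‖ ^ 2 = z.re ^ 2 + z.im ^ 2 := by
  rw [← Complex.normSq_eq_norm_sq, Complex.normSq_apply]; ring

theorem sq_re_eq (z : ℂ) : (z ^ 2).re = z.re ^ 2 - z.im ^ 2 := by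
  rw [pow_two, Complex.mul_re]; ring

theorem sum_edge_congr (hd : 0 < d) {Δ : ℕ} {i j : HermForm d → HermForm d}
    (hi : ∀ h ∈ edge hd Δ, i h ∈ edge hd Δ) (hj : ∀ h ∈ edge hd Δ, j h ∈ edge hd Δ)
    (hij : ∀ h, i (j h) = h) (hji : ∀ h, j (i h) = h) (f : HermForm d → ℝ) :
    ∑ h ∈ edge hd Δ, f (i h) = ∑ h ∈ edge hd Δ, f h :=
  Finset.sum_nbij' i j hi hj (fun h _ => hji h) (fun h _ => hij h) fun _ _ => rfl

theorem mem_edge_congr (hd : 0 < d) {Δ : ℕ} {h h' : HermForm d} (ha : h'.a = h.a) (hc : h'.c = h.c)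
    (hdisc : h'.discr = h.discr) (hh : h ∈ edge hd Δ) : h' ∈ edge hd Δ := by
  rw [mem_edge] at hh ⊢
  rwa [ha, hc, hdisc]

theorem sum_edge_conj (hd : 0 < d) {Δ : ℕ} (f : ℝ → ℂ → ℝ → ℝ) :
    ∑ h ∈ edge hd Δ, f h.a ((starRingEnd ℂ) (toC h.b)) h.c
      = ∑ h ∈ edge hd Δ, f h.a (toC h.b) h.c := by
  have hc : ∀ h ∈ edge hd Δ, conj h ∈ edge hd Δ := fun h =>
    mem_edge_congr hd rfl rfl (discr_conj hd h)
  have hi : ∀ h : HermForm d, conj (conj h) = h := fun h =>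
    ext_eval fun z => by rw [eval_conj hd, eval_conj hd, Complex.conj_conj]
  rw [← sum_edge_congr hd hc hc hi hi fun h => f h.a (toC h.b) h.c]
  simp only [conj, toC_conjO hd]

theorem sum_edge_rotate (hd : 0 < d) {Δ : ℕ} {ε : 𝓞 (K d)}
    (hε : Complex.normSq (toC ε) = 1) (f : ℝ → ℂ → ℝ → ℝ) :
    ∑ h ∈ edge hd Δ, f h.a (toC h.b * toC ε) h.c = ∑ h ∈ edge hd Δ, f h.a (toC h.b) h.c := by
  have hε' : Complex.normSq (toC (conjO ε)) = 1 := by rwa [toC_conjO hd, Complex.normSq_conj]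
  have h1 : toC ε * toC (conjO ε) = 1 := by
    rw [toC_conjO hd, Complex.mul_conj, hε, Complex.ofReal_one]
  exact sum_edge_congr hd (i := rotate ε) (j := rotate (conjO ε))
    (fun h => mem_edge_congr hd rfl rfl (discr_rotate hd hε h))
    (fun h => mem_edge_congr hd rfl rfl (discr_rotate hd hε' h))
    (fun h => ext_eval fun z => by
      rw [eval_rotate hε, eval_rotate hε', ← mul_assoc, mul_comm (toC (conjO ε)), h1, one_mul])
    (fun h => ext_eval fun z => by
      rw [eval_rotate hε', eval_rotate hε, ← mul_assoc, h1, one_mul])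
    fun h => f h.a (toC h.b) h.c

theorem sum_edge_neg (hd : 0 < d) {Δ : ℕ} (f : ℝ → ℂ → ℝ → ℝ) :
    ∑ h ∈ edge hd Δ, f h.a (-toC h.b) h.c = ∑ h ∈ edge hd Δ, f h.a (toC h.b) h.c := by
  have := sum_edge_rotate hd (Δ := Δ) (ε := -1) (by simp) f
  simpa using this

/-- The map h ↦ -`swap` h preserves a < 0 < c; it pairs the coefficient of |z|^{2j} in P with that
of |z|^{2(k-j)}, up to sign. -/
theorem sum_edge_flip (hd : 0 < d) {Δ : ℕ} (f : ℝ → ℂ → ℝ → ℝ) :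
    ∑ h ∈ edge hd Δ, f (-h.c) (toC h.b) (-h.a) = ∑ h ∈ edge hd Δ, f h.a (toC h.b) h.c := by
  have hc : ∀ h ∈ edge hd Δ, (⟨-h.c, h.b, -h.a⟩ : HermForm d) ∈ edge hd Δ := fun h hh => by
    simp only [mem_edge, HermForm.discr] at hh ⊢
    exact ⟨by rw [← hh.1]; ring, by omega, by omega⟩
  rw [← sum_edge_congr hd hc hc (fun h => by simp) (fun h => by simp)
    fun h => f h.a (toC h.b) h.c]
  simp

theorem period_one (hd : 0 < d) (Δ : ℕ) (z : ℂ) :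
    period hd 1 Δ z = (∑ h ∈ edge hd Δ, (h.c : ℝ) ^ 1) * (1 - (‖z‖ ^ 2) ^ 1) := by
  have h1 := sum_edge_neg hd (Δ := Δ) fun a b c => (a * ‖z‖ ^ 2 + 2 * (b * z).re + c) ^ 1
  have h2 := sum_edge_flip hd (Δ := Δ) fun a b c => c * ‖z‖ ^ 2
  -- The double sign makes the summand -a|z|² of the flipped sum in `h2` appear literally.
  have h3 : ∑ h ∈ edge hd Δ, ((h.a * ‖z‖ ^ 2 + 2 * (-toC h.b * z).re + h.c) ^ 1 +
      (h.a * ‖z‖ ^ 2 + 2 * (toC h.b * z).re + h.c) ^ 1 - 2 * (-h.a * ‖z‖ ^ 2 * -1 + h.c) : ℝ) = 0 :=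
    Finset.sum_eq_zero fun h _ => by simp; ring
  simp only [Finset.sum_add_distrib, Finset.sum_sub_distrib, ← Finset.mul_sum, ← Finset.sum_mul,
    pow_one, period, HermForm.eval] at h1 h2 h3 ⊢
  linear_combination (h3 - h1) / 2 - h2

/-- The sum of `(r + 2 Re (ε (X + iY)))⁵` over the sixth roots of unity `ε`. -/
theorem hexagon_pow_five (r X Y s : ℝ) (hs : s ^ 2 = 3) :
    (r + 2 * X) ^ 5 + (r - 2 * X) ^ 5 + (r + (X - s * Y)) ^ 5 + (r - (X - s * Y)) ^ 5
      + (r + (-X - s * Y)) ^ 5 + (r - (-X - s * Y)) ^ 5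
      = 6 * (r ^ 5 + 20 * r ^ 3 * (X ^ 2 + Y ^ 2) + 30 * r * (X ^ 2 + Y ^ 2) ^ 2) := by
  linear_combination (40 * r ^ 3 * Y ^ 2 + 120 * r * X ^ 2 * Y ^ 2
    + 20 * r * Y ^ 4 * (s ^ 2 + 3)) * hs

/-- Averaging over ±b and their conjugates kills odd powers of Re(bz) and turns Re(bz)² into
(|b|²|z|² + Re b² Re z²)/2. The flip then makes the result antisymmetric. -/
theorem period_three (hd : 0 < d) (Δ : ℕ) : ∃ p q : ℝ, ∀ z : ℂ,
    period hd 3 Δ z = (∑ h ∈ edge hd Δ, (h.c : ℝ) ^ 3) * (1 - (‖z‖ ^ 2) ^ 3)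
      + p * (‖z‖ ^ 2 - (‖z‖ ^ 2) ^ 2) + q * ((1 - ‖z‖ ^ 2) * (z ^ 2).re) := by
  refine ⟨∑ h ∈ edge hd Δ, (3 * h.a * h.c ^ 2 + 6 * h.c * Complex.normSq (toC h.b) : ℝ),
    ∑ h ∈ edge hd Δ, (6 * h.c * (toC h.b ^ 2).re : ℝ), fun z => ?_⟩
  set u := ‖z‖ ^ 2 with hu
  have hu' : u = z.re ^ 2 + z.im ^ 2 := norm_sq_eq_re_im z
  let f (a : ℝ) (b : ℂ) (c : ℝ) : ℝ := (a * u + 2 * (b * z).re + c) ^ 3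
  let f₁ (a : ℝ) (b : ℂ) (c : ℝ) : ℝ := f a b c + f a (-b) c
  let f₂ (a : ℝ) (b : ℂ) (c : ℝ) : ℝ := f₁ a b c + f₁ a ((starRingEnd ℂ) b) c
  let g (a : ℝ) (b : ℂ) (c : ℝ) : ℝ := c ^ 3 * (1 - u ^ 3)
    + (3 * a * c ^ 2 + 6 * c * Complex.normSq b) * (u - u ^ 2)
    + 6 * c * (b ^ 2).re * ((1 - u) * (z ^ 2).re)
  have h1 := sum_edge_neg hd (Δ := Δ) f
  have h2 := sum_edge_conj hd (Δ := Δ) f₁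
  have h3 := sum_edge_flip hd (Δ := Δ) f₂
  have h4 := sum_edge_flip hd (Δ := Δ) g
  have key : ∀ (a c : ℝ) (b : ℂ), f₂ a b c + f₂ (-c) b (-a) = 4 * (g a b c + g (-c) b (-a)) := by
    intro a c b
    simp only [f₂, f₁, f, g, hu', Complex.normSq_apply, Complex.mul_re, Complex.neg_re,
      Complex.neg_im, Complex.conj_re, Complex.conj_im, pow_two]
    ring
  have h5 : ∑ h ∈ edge hd Δ, f₂ h.a (toC h.b) h.c + ∑ h ∈ edge hd Δ, f₂ (-h.c) (toC h.b) (-h.a)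
      = 4 * (∑ h ∈ edge hd Δ, g h.a (toC h.b) h.c
        + ∑ h ∈ edge hd Δ, g (-h.c) (toC h.b) (-h.a)) := by
    rw [← Finset.sum_add_distrib, ← Finset.sum_add_distrib, Finset.mul_sum]
    exact Finset.sum_congr rfl fun h _ => key _ _ _
  have h6 : ∑ h ∈ edge hd Δ, f₂ h.a (toC h.b) h.c = ∑ h ∈ edge hd Δ, f₁ h.a (toC h.b) h.c
      + ∑ h ∈ edge hd Δ, f₁ h.a ((starRingEnd ℂ) (toC h.b)) h.c := Finset.sum_add_distrib
  have h7 : ∑ h ∈ edge hd Δ, f₁ h.a (toC h.b) h.c = ∑ h ∈ edge hd Δ, f h.a (toC h.b) h.c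
      + ∑ h ∈ edge hd Δ, f h.a (-toC h.b) h.c := Finset.sum_add_distrib
  have h8 : period hd 3 Δ z = ∑ h ∈ edge hd Δ, f h.a (toC h.b) h.c := rfl
  rw [h8, Finset.sum_mul, Finset.sum_mul, Finset.sum_mul, ← Finset.sum_add_distrib,
    ← Finset.sum_add_distrib]
  change _ = ∑ h ∈ edge hd Δ, g h.a (toC h.b) h.c
  linarith

/-- For d = 3 the sixth roots of unity are units. Averaging over them leaves only powers of |bz|²,
so no angular term survives; the flip pairs the remaining coefficients. -/
theorem period_five {Δ : ℕ} (hd : 0 < 3) : ∃ p q : ℝ, ∀ z : ℂ,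
    period hd 5 Δ z = (∑ h ∈ edge hd Δ, (h.c : ℝ) ^ 5) * (1 - (‖z‖ ^ 2) ^ 5)
      + p * (‖z‖ ^ 2 - (‖z‖ ^ 2) ^ 4) + q * ((‖z‖ ^ 2) ^ 2 - (‖z‖ ^ 2) ^ 3) := by
  refine ⟨∑ h ∈ edge hd Δ, (5 * h.a * h.c ^ 4 + 20 * h.c ^ 3 * Complex.normSq (toC h.b) : ℝ),
    ∑ h ∈ edge hd Δ, (10 * h.a ^ 2 * h.c ^ 3 + 60 * h.a * h.c ^ 2 * Complex.normSq (toC h.b)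
      + 30 * h.c * Complex.normSq (toC h.b) ^ 2 : ℝ), fun z => ?_⟩
  set u := ‖z‖ ^ 2 with hu
  have hu' : u = z.re ^ 2 + z.im ^ 2 := norm_sq_eq_re_im z
  obtain ⟨ε, hε⟩ := exists_toC_eq_half (d := 3) (n := 1) rfl
  set s : ℝ := Real.sqrt (3 : ℕ)
  have hs : s ^ 2 = 3 := by rw [Real.sq_sqrt] <;> norm_num
  have hre : (toC ε).re = 1 / 2 := by simp [hε]
  have him : (toC ε).im = s / 2 := by simp [hε]
  have hε1 : Complex.normSq (toC ε) = 1 := by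
    rw [Complex.normSq_apply, hre, him]; linarith
  let f (a : ℝ) (b : ℂ) (c : ℝ) : ℝ := (a * u + 2 * (b * z).re + c) ^ 5
  let f₁ (a : ℝ) (b : ℂ) (c : ℝ) : ℝ := f a b c + f a (-b) c
  let f₂ (a : ℝ) (b : ℂ) (c : ℝ) : ℝ := f₁ a (b * toC ε) c
  let f₃ (a : ℝ) (b : ℂ) (c : ℝ) : ℝ := f₂ a (b * toC ε) c
  let f₄ (a : ℝ) (b : ℂ) (c : ℝ) : ℝ := f₁ a b c + f₂ a b c + f₃ a b c
  let g (a : ℝ) (b : ℂ) (c : ℝ) : ℝ := c ^ 5 * (1 - u ^ 5)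
    + (5 * a * c ^ 4 + 20 * c ^ 3 * Complex.normSq b) * (u - u ^ 4)
    + (10 * a ^ 2 * c ^ 3 + 60 * a * c ^ 2 * Complex.normSq b + 30 * c * Complex.normSq b ^ 2)
      * (u ^ 2 - u ^ 3)
  have h1 := sum_edge_neg hd (Δ := Δ) f
  have h2 : ∑ h ∈ edge hd Δ, f₂ h.a (toC h.b) h.c = ∑ h ∈ edge hd Δ, f₁ h.a (toC h.b) h.c :=
    sum_edge_rotate hd hε1 f₁
  have h3 : ∑ h ∈ edge hd Δ, f₃ h.a (toC h.b) h.c = ∑ h ∈ edge hd Δ, f₂ h.a (toC h.b) h.c :=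
    sum_edge_rotate hd hε1 f₂
  have h4 := sum_edge_flip hd (Δ := Δ) g
  have h4' := sum_edge_flip hd (Δ := Δ) f₄
  have key₁ : ∀ (a c : ℝ) (b : ℂ), f₄ a b c = 6 * ((a * u + c) ^ 5
      + 20 * (a * u + c) ^ 3 * (Complex.normSq b * u)
      + 30 * (a * u + c) * (Complex.normSq b * u) ^ 2) := by
    intro a c b
    have hN : Complex.normSq b * u = (b * z).re ^ 2 + (b * z).im ^ 2 := by
      rw [hu, ← Complex.normSq_eq_norm_sq, ← map_mul, Complex.normSq_apply]; ring
    have hr1 : (b * toC ε * z).re = ((b * z).re - s * (b * z).im) / 2 := by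
      rw [mul_right_comm, Complex.mul_re, hre, him]; ring
    have hi1 : (b * toC ε * z).im = ((b * z).im + s * (b * z).re) / 2 := by
      rw [mul_right_comm, Complex.mul_im, hre, him]; ring
    have hr2 : (b * toC ε * toC ε * z).re = (-(b * z).re - s * (b * z).im) / 2 := by
      rw [mul_right_comm, Complex.mul_re, hr1, hi1, hre, him]
      linear_combination (-(b * z).re / 4) * hs
    rw [hN, ← hexagon_pow_five (a * u + c) (b * z).re (b * z).im s hs]
    simp only [f₄, f₃, f₂, f₁, f, neg_mul, Complex.neg_re, hr1, hr2]
    ring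
  have key : ∀ (a c : ℝ) (b : ℂ), f₄ a b c + f₄ (-c) b (-a) = 6 * (g a b c + g (-c) b (-a)) := by
    intro a c b
    rw [key₁, key₁]
    simp only [g]
    ring
  have h5 : ∑ h ∈ edge hd Δ, f₄ h.a (toC h.b) h.c + ∑ h ∈ edge hd Δ, f₄ (-h.c) (toC h.b) (-h.a)
      = 6 * (∑ h ∈ edge hd Δ, g h.a (toC h.b) h.c
        + ∑ h ∈ edge hd Δ, g (-h.c) (toC h.b) (-h.a)) := by
    rw [← Finset.sum_add_distrib, ← Finset.sum_add_distrib, Finset.mul_sum]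
    exact Finset.sum_congr rfl fun h _ => key _ _ _
  have h6 : ∑ h ∈ edge hd Δ, f₄ h.a (toC h.b) h.c = ∑ h ∈ edge hd Δ, f₁ h.a (toC h.b) h.c
      + ∑ h ∈ edge hd Δ, f₂ h.a (toC h.b) h.c + ∑ h ∈ edge hd Δ, f₃ h.a (toC h.b) h.c := by
    rw [← Finset.sum_add_distrib, ← Finset.sum_add_distrib]
  have h7 : ∑ h ∈ edge hd Δ, f₁ h.a (toC h.b) h.c = ∑ h ∈ edge hd Δ, f h.a (toC h.b) h.c
      + ∑ h ∈ edge hd Δ, f h.a (-toC h.b) h.c := Finset.sum_add_distrib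
  have h8 : period hd 5 Δ z = ∑ h ∈ edge hd Δ, f h.a (toC h.b) h.c := rfl
  rw [h8, Finset.sum_mul, Finset.sum_mul, Finset.sum_mul, ← Finset.sum_add_distrib,
    ← Finset.sum_add_distrib]
  change _ = ∑ h ∈ edge hd Δ, g h.a (toC h.b) h.c
  linarith

theorem period_rotate (hd : 0 < d) {k Δ : ℕ} {ε : 𝓞 (K d)} (hε : Complex.normSq (toC ε) = 1)
    (z : ℂ) : period hd k Δ (toC ε * z) = period hd k Δ z := by
  have := sum_edge_rotate hd (Δ := Δ) hε fun a b c => (a * ‖z‖ ^ 2 + 2 * (b * z).re + c) ^ k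
  simp only [period]
  rw [Finset.sum_congr rfl fun h _ => by rw [← eval_rotate hε h z]]
  simpa only [HermForm.eval, rotate, toC_mul] using this

end Period

/-! ### Linear relations for the period from cycles of cusps -/

section Relations

variable {d : ℕ}

theorem H_add (hd : d = 1 ∨ d = 2 ∨ d = 3 ∨ d = 7 ∨ d = 11) {k Δ : ℕ} (hk : Odd k)
    (hnorm : ¬ ∃ b : 𝓞 (K d), Algebra.norm ℤ b = (Δ : ℤ)) {z : ℂ} (hz : z ∈ K d) (β : 𝓞 (K d)) :
    H d k Δ (z + toC β) = H d k Δ z := by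
  rw [H_eq_tsum hk.pos.ne', H_eq_tsum hk.pos.ne']
  exact ((hasSum_term_add (pos_of_mem hd) β).mpr
    (summable_term_of_mem hd hk hnorm hz).hasSum).tsum_eq

theorem H_neg (hd : d = 1 ∨ d = 2 ∨ d = 3 ∨ d = 7 ∨ d = 11) {k Δ : ℕ} (hk : Odd k)
    (hnorm : ¬ ∃ b : 𝓞 (K d), Algebra.norm ℤ b = (Δ : ℤ)) {z : ℂ} (hz : z ∈ K d) :
    H d k Δ (-z) = H d k Δ z := by
  rw [H_eq_tsum hk.pos.ne', H_eq_tsum hk.pos.ne']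
  exact ((hasSum_term_neg (pos_of_mem hd)).mpr
    (summable_term_of_mem hd hk hnorm hz).hasSum).tsum_eq

theorem H_inv (hd : d = 1 ∨ d = 2 ∨ d = 3 ∨ d = 7 ∨ d = 11) {k Δ : ℕ} (hk : Odd k)
    (hnorm : ¬ ∃ b : 𝓞 (K d), Algebra.norm ℤ b = (Δ : ℤ)) {z : ℂ} (hz : z ∈ K d) (h0 : z ≠ 0) :
    H d k Δ z = (‖z‖ ^ 2) ^ k * H d k Δ z⁻¹ + period (pos_of_mem hd) k Δ z := by
  rw [H_eq_tsum hk.pos.ne', H_eq_tsum hk.pos.ne']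
  exact (hasSum_term_inv' (pos_of_mem hd) hk hnorm h0
    (summable_term_of_mem hd hk hnorm (inv_mem hz)).hasSum).tsum_eq

/-- The relation of the period function coming from the triangle `∞, 0, 1` of cusps. -/
theorem period_triangle (hd : d = 1 ∨ d = 2 ∨ d = 3 ∨ d = 7 ∨ d = 11) {k Δ : ℕ} (hk : Odd k)
    (hnorm : ¬ ∃ b : 𝓞 (K d), Algebra.norm ℤ b = (Δ : ℤ)) {z : ℂ} (hz : z ∈ K d) (h0 : z ≠ 0)
    (h1 : z ≠ 1) :
    (‖z‖ ^ 2) ^ k * period (pos_of_mem hd) k Δ (z⁻¹ - 1)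
      = period (pos_of_mem hd) k Δ (z - 1) - period (pos_of_mem hd) k Δ z := by
  have hz1 : z - 1 ∈ K d := sub_mem hz (one_mem _)
  have hz2 : z⁻¹ - 1 ∈ K d := sub_mem (inv_mem hz) (one_mem _)
  have h10 : z - 1 ≠ 0 := sub_ne_zero.mpr h1
  have e0 : z⁻¹ - 1 = -((z - 1) * z⁻¹) := by field_simp; ring
  have h20 : z⁻¹ - 1 ≠ 0 := by
    rw [e0]; exact neg_ne_zero.mpr (mul_ne_zero h10 (inv_ne_zero h0))
  -- Up to translation and sign, the six arguments of H pair off: z with z-1, z⁻¹ with z⁻¹-1, and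
  -- (z-1)⁻¹ with (z⁻¹-1)⁻¹. The weights agree by `e2`.
  have a1 := H_inv hd hk hnorm hz h0
  have a2 := H_inv hd hk hnorm hz1 h10
  have a3 := H_inv hd hk hnorm hz2 h20
  have t1 := H_add hd hk hnorm hz1 1
  have t2 := H_add hd hk hnorm hz2 1
  have t3 := H_add hd hk hnorm (inv_mem hz1) 1
  have t4 := H_neg hd hk hnorm (add_mem (inv_mem hz1) (one_mem _))
  have e1 : (z⁻¹ - 1)⁻¹ = -((z - 1)⁻¹ + 1) := by
    rw [e0, inv_neg, mul_inv, inv_inv]; field_simp; ring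
  have e2 : (‖z⁻¹ - 1‖ ^ 2) ^ k * (‖z‖ ^ 2) ^ k = (‖z - 1‖ ^ 2) ^ k := by
    have : ‖z‖ ≠ 0 := norm_ne_zero_iff.mpr h0
    rw [e0, norm_neg, norm_mul, norm_inv, ← mul_pow]
    field_simp
  rw [toC_one, sub_add_cancel] at t1 t2
  rw [toC_one] at t3
  rw [e1, t4, t3] at a3
  rw [← t2] at a3
  linear_combination (-(‖z‖ ^ 2) ^ k) * a3 + a2 - a1 + t1 - H d k Δ (z - 1)⁻¹ * e2

/-- The relation of the period function of `ℚ(√-7)` coming from a square face of cusps, evaluated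
at `z = 2`. -/
theorem period_square {k Δ : ℕ} (hd : 7 = 1 ∨ 7 = 2 ∨ 7 = 3 ∨ 7 = 7 ∨ 7 = 11) (hk : Odd k)
    (hnorm : ¬ ∃ b : 𝓞 (K 7), Algebra.norm ℤ b = (Δ : ℤ)) {w : ℂ}
    (hw : w = Complex.I * (Real.sqrt (7 : ℕ) : ℂ)) :
    period (pos_of_mem hd) k Δ 2 + 4 ^ k * period (pos_of_mem hd) k Δ (-w / 2)
      + 7 ^ k * period (pos_of_mem hd) k Δ ((7 - 3 * w) / 14)
      + 4 ^ k * period (pos_of_mem hd) k Δ ((3 - w) / 8) = 0 := by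
  obtain ⟨t, ht⟩ := exists_toC_eq_half (d := 7) (n := 2) rfl
  rw [← hw] at ht
  have hs : Real.sqrt (7 : ℕ) ^ 2 = 7 := by rw [Real.sq_sqrt] <;> norm_num
  have hw2 : w ^ 2 = -7 := by rw [hw, sqrt_sq]; norm_num
  have hwre : w.re = 0 := by simp [hw]
  have hwim : w.im ^ 2 = 7 := by simp [hw]
  have hwK : w ∈ K 7 := hw ▸ sqrt_mem 7
  have hw0 : w ≠ 0 := by rintro rfl; norm_num at hw2
  have n (m : ℕ) [m.AtLeastTwo] : (ofNat(m) : ℂ) ∈ K 7 := ofNat_mem _ m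
  have n2 : (2 : ℂ) ∈ K 7 := n 2
  have m1 : -w / 2 ∈ K 7 := div_mem (neg_mem hwK) (n 2)
  have m2 : (7 - 3 * w) / 14 ∈ K 7 := div_mem (sub_mem (n 7) (mul_mem (n 3) hwK)) (n 14)
  have m3 : (3 - w) / 8 ∈ K 7 := div_mem (sub_mem (n 3) hwK) (n 8)
  have u0 : ‖(2 : ℂ)‖ ^ 2 = 4 := by norm_num
  have u1 : ‖-w / 2‖ ^ 2 = 7 / 4 := by rw [norm_sq_eq_re_im]; simp [hwre, div_pow, hwim]; norm_num
  have u2 : ‖(7 - 3 * w) / 14‖ ^ 2 = 4 / 7 := by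
    rw [norm_sq_eq_re_im]; simp [hwre, div_pow, mul_pow, hwim]; norm_num
  have u3 : ‖(3 - w) / 8‖ ^ 2 = 1 / 4 := by rw [norm_sq_eq_re_im]; simp [hwre, div_pow, hwim]; norm_num
  have ne {z : ℂ} {x : ℝ} (h : ‖z‖ ^ 2 = x) (hx : 0 < x) : z ≠ 0 := by
    rintro rfl; simp at h; linarith
  -- The inverse of each point is an integral translate of the next, cyclically. The squared
  -- absolute values 4, 7/4, 4/7, 1/4 multiply to 1, so H(2) cancels after one round.
  have a0 := H_inv hd hk hnorm n2 two_ne_zero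
  have a1 := H_inv hd hk hnorm m1 (ne u1 (by norm_num))
  have a2 := H_inv hd hk hnorm m2 (ne u2 (by norm_num))
  have a3 := H_inv hd hk hnorm m3 (ne u3 (by norm_num))
  have t0 := H_add hd hk hnorm m1 t
  have t1 := H_add hd hk hnorm m2 (t - 1)
  have t2 := H_add hd hk hnorm m3 t
  have t3 := H_add hd hk hnorm n2 (t - 1)
  rw [ht, show -w / 2 + (1 + w) / 2 = (2 : ℂ)⁻¹ by ring] at t0
  rw [toC_sub, ht, toC_one, show (7 - 3 * w) / 14 + ((1 + w) / 2 - 1) = (-w / 2)⁻¹ by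
    field_simp; linear_combination 8 * hw2] at t1
  rw [ht, show (3 - w) / 8 + (1 + w) / 2 = ((7 - 3 * w) / 14)⁻¹ by
    apply eq_inv_of_mul_eq_one_left
    linear_combination (-9 / 112 : ℂ) * hw2] at t2
  rw [toC_sub, ht, toC_one, show 2 + ((1 + w) / 2 - 1) = ((3 - w) / 8)⁻¹ by
    apply eq_inv_of_mul_eq_one_left
    linear_combination (-1 / 16 : ℂ) * hw2] at t3
  rw [t0, u0] at a0
  rw [t1, u1] at a1
  rw [t2, u2] at a2
  rw [t3, u3] at a3
  have p1 : (4 : ℝ) ^ k * (7 / 4) ^ k = 7 ^ k := by rw [← mul_pow]; norm_num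
  have p2 : (7 : ℝ) ^ k * (4 / 7) ^ k = 4 ^ k := by rw [← mul_pow]; norm_num
  have p3 : (4 : ℝ) ^ k * (1 / 4) ^ k = 1 := by rw [← mul_pow]; norm_num
  rw [a1, mul_add, ← mul_assoc, p1, a2, mul_add, ← mul_assoc, p2, a3, mul_add, ← mul_assoc, p3]
    at a0
  linarith

end Relations

/-! ### Vanishing of the extra coefficients and the divisor sum -/

section Main

variable {d : ℕ}

theorem period_three_eq (hd : d = 1 ∨ d = 2 ∨ d = 3 ∨ d = 7 ∨ d = 11) (hd' : d = 1 ∨ d = 3 ∨ d = 7)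
    {Δ : ℕ} (hnorm : ¬ ∃ b : 𝓞 (K d), Algebra.norm ℤ b = (Δ : ℤ)) (z : ℂ) :
    period (pos_of_mem hd) 3 Δ z
      = (∑ h ∈ edge (pos_of_mem hd) Δ, (h.c : ℝ) ^ 3) * (1 - (‖z‖ ^ 2) ^ 3) := by
  obtain ⟨p, q, hP⟩ := period_three (pos_of_mem hd) Δ
  -- At real points Re z² = |z|², so only p + q is visible; z = 3 shows that it vanishes.
  have h1 := period_triangle hd (k := 3) (by decide) hnorm (ofNat_mem (K d) 3) (by norm_num)
    (by norm_num)
  have hpq : p + q = 0 := by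
    simp only [hP] at h1
    norm_num at h1
    linarith
  have hq : q = 0 := by
    rcases hd' with rfl | rfl | rfl
    · obtain ⟨s, hs⟩ := exists_toC_eq_sqrt 1
      have hI : toC s = Complex.I := by simpa using hs
      have h2 := period_rotate (k := 3) (Δ := Δ) (pos_of_mem hd) (ε := s) (by simp [hI]) 2
      simp only [hP, hI, norm_mul, mul_pow, Complex.I_sq] at h2
      norm_num at h2
      linarith
    · obtain ⟨s, hs⟩ := exists_toC_eq_half (d := 3) (n := 1) rfl
      have h3 : Real.sqrt 3 ^ 2 = 3 := Real.sq_sqrt (by norm_num)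
      have hn : Complex.normSq (toC s) = 1 := by
        rw [hs, Complex.normSq_apply]
        simp
        norm_num
        linarith
      have hn' : ‖toC s‖ ^ 2 = 1 := by rw [← Complex.normSq_eq_norm_sq, hn]
      have hre : (toC s ^ 2).re = -1 / 2 := by
        rw [hs, pow_two, Complex.mul_re]
        simp
        norm_num
        linarith
      have hre' : ((toC s * 2) ^ 2).re = -2 := by
        rw [mul_pow, show (2 : ℂ) ^ 2 = ((4 : ℝ) : ℂ) by norm_num, Complex.re_mul_ofReal, hre]
        norm_num
      have h2 := period_rotate (k := 3) (Δ := Δ) (pos_of_mem hd) hn 2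
      simp only [hP, norm_mul, mul_pow ‖toC s‖, hn', hre'] at h2
      norm_num at h2
      linarith
    -- The units ±1 give nothing here. With p = -q the extra term is -2q(1 - |z|²)(Im z)², and the
    -- square relation detects it.
    · have h2 := period_square hd (k := 3) (by decide) hnorm rfl
      set w : ℂ := Complex.I * (Real.sqrt (7 : ℕ) : ℂ) with hw
      have hwre : w.re = 0 := by simp [hw]
      have hwim : w.im ^ 2 = 7 := by simp [hw]
      simp only [hP, norm_sq_eq_re_im, sq_re_eq] at h2
      simp [hwre, hwim, div_pow, mul_pow] at h2
      norm_num at h2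
      linarith
  rw [hP, hq, show p = 0 by linarith]
  ring

theorem period_five_eq (hd : 3 = 1 ∨ 3 = 2 ∨ 3 = 3 ∨ 3 = 7 ∨ 3 = 11)
    {Δ : ℕ} (hnorm : ¬ ∃ b : 𝓞 (K 3), Algebra.norm ℤ b = (Δ : ℤ)) (z : ℂ) :
    period (pos_of_mem hd) 5 Δ z
      = (∑ h ∈ edge (pos_of_mem hd) Δ, (h.c : ℝ) ^ 5) * (1 - (‖z‖ ^ 2) ^ 5) := by
  obtain ⟨p, q, hP⟩ := period_five (Δ := Δ) (pos_of_mem hd)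
  -- The point z = 3 gives 3p + q = 0, and z = 1 + √-3 below gives the independent relation 45p +
  -- 19q = 0.
  have h1 := period_triangle hd (k := 5) (by decide) hnorm (ofNat_mem (K 3) 3) (by norm_num)
    (by norm_num)
  set w : ℂ := Complex.I * (Real.sqrt (3 : ℕ) : ℂ) with hw
  have hwre : w.re = 0 := by simp [hw]
  have hwim : w.im ^ 2 = 3 := by simp [hw]
  have u1 : ‖1 + w‖ ^ 2 = 4 := by rw [norm_sq_eq_re_im]; simp [hwre, hwim]; norm_num
  have u2 : ‖(1 + w) - 1‖ ^ 2 = 3 := by rw [norm_sq_eq_re_im]; simp [hwre, hwim]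
  have hne : 1 + w ≠ 0 := by
    intro h; rw [h] at u1; norm_num at u1
  have hne1 : 1 + w ≠ 1 := by
    intro h; rw [h] at u2; norm_num at u2
  have u3 : ‖(1 + w)⁻¹ - 1‖ ^ 2 = 3 / 4 := by
    have : (1 + w)⁻¹ - 1 = -((1 + w) - 1) / (1 + w) := by field_simp; ring
    rw [this, norm_div, norm_neg, div_pow, u1, u2]
  have h2 := period_triangle hd (k := 5) (by decide) hnorm
    (add_mem (one_mem _) (sqrt_mem 3)) hne hne1
  rw [← hw, hP, hP, hP, u1, u2, u3] at h2
  simp only [hP] at h1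
  norm_num at h1 h2
  rw [hP, show p = 0 by linarith, show q = 0 by linarith]
  ring

/-- The forms separating `∞` and `0` are enumerated by `b` and a divisor `c` of `Δ - N(b)`. -/
theorem sum_edge_eq (hd : 0 < d) (k Δ : ℕ) :
    ∑ h ∈ edge hd Δ, (h.c : ℝ) ^ k =
      ∑ᶠ (b : 𝓞 (K d)) (_ : Algebra.norm ℤ b < (Δ : ℤ)),
        (ArithmeticFunction.sigma k ((Δ : ℤ) - Algebra.norm ℤ b).toNat : ℝ) := by
  have hS := finite_norm_lt hd (d := d) Δ
  have h1 := finsum_mem_eq_finite_toFinset_sum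
    (fun b : 𝓞 (K d) => (ArithmeticFunction.sigma k ((Δ : ℤ) - Algebra.norm ℤ b).toNat : ℝ)) hS
  refine Eq.trans ?_ h1.symm
  simp only [ArithmeticFunction.sigma_apply, Nat.cast_sum, Nat.cast_pow]
  rw [Finset.sum_sigma']
  refine Finset.sum_bij' (fun h _ => ⟨h.b, h.c.toNat⟩)
    (fun x _ => ⟨-(((Δ : ℤ) - Algebra.norm ℤ x.1) / x.2), x.1, x.2⟩) ?_ ?_ ?_ ?_ ?_
  · intro h hh
    obtain ⟨hD, ha, hc⟩ := (mem_edge hd).mp hh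
    rw [HermForm.discr] at hD
    have h2 : (Δ : ℤ) - Algebra.norm ℤ h.b = h.c * -h.a := by linarith
    have h3 : 0 < h.c * -h.a := mul_pos hc (by omega)
    simp only [Finset.mem_sigma, Set.Finite.mem_toFinset, Set.mem_ofPred_eq, Nat.mem_divisors]
    refine ⟨by linarith, ?_, by omega⟩
    rw [← Int.natCast_dvd_natCast, Int.toNat_of_nonneg hc.le, Int.toNat_of_nonneg (by omega), h2]
    exact dvd_mul_right _ _
  · rintro ⟨b, c⟩ hx
    simp only [Finset.mem_sigma, Set.Finite.mem_toFinset, Set.mem_ofPred_eq, Nat.mem_divisors] at hx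
    obtain ⟨hb, hc, h0⟩ := hx
    have hc' : (c : ℤ) ∣ (Δ : ℤ) - Algebra.norm ℤ b := by
      have := Int.natCast_dvd_natCast.mpr hc
      rwa [Int.toNat_of_nonneg (by omega)] at this
    have hcpos : (0 : ℤ) < c := by
      exact_mod_cast Nat.pos_of_dvd_of_pos hc (Nat.pos_of_ne_zero h0)
    rw [mem_edge]
    refine ⟨?_, ?_, hcpos⟩
    · simp only [HermForm.discr]
      rw [neg_mul, Int.ediv_mul_cancel hc']
      ring
    · have hb' : Algebra.norm ℤ b < (Δ : ℤ) := hb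
      exact neg_lt_zero.mpr (Int.ediv_pos_of_pos_of_dvd (sub_pos.mpr hb') hcpos.le hc')
  · intro h hh
    obtain ⟨hD, ha, hc⟩ := (mem_edge hd).mp hh
    rw [HermForm.discr] at hD
    have h2 : (Δ : ℤ) - Algebra.norm ℤ h.b = -h.a * h.c := by linarith
    simp only [Int.toNat_of_nonneg hc.le, h2, Int.mul_ediv_cancel _ hc.ne', neg_neg]
  · rintro ⟨b, c⟩ _
    simp
  · intro h hh
    have hc := ((mem_edge hd).mp hh).2.2
    have : ((h.c.toNat : ℤ) : ℝ) = h.c := by rw [Int.toNat_of_nonneg hc.le]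
    rw [← this, Int.cast_natCast]

theorem summable_and_H_eq (hd : d = 1 ∨ d = 2 ∨ d = 3 ∨ d = 7 ∨ d = 11) {k Δ : ℕ}
    (hk : Odd k) (hnorm : ¬ ∃ b : 𝓞 (K d), Algebra.norm ℤ b = (Δ : ℤ))
    (hP : ∀ z, period (pos_of_mem hd) k Δ z
      = (∑ h ∈ edge (pos_of_mem hd) Δ, (h.c : ℝ) ^ k) * (1 - (‖z‖ ^ 2) ^ k)) (z : ℂ) :
    Summable (fun h : forms d Δ z => (h : HermForm d).eval z ^ k) ∧ H d k Δ z = H d k Δ 0 := by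
  have h := hasSum_term_of_period_eq hd hk hnorm hP
  rw [summable_forms_iff hk.pos.ne', H_eq_tsum hk.pos.ne', H_eq_tsum hk.pos.ne', (h z).tsum_eq,
    (h 0).tsum_eq]
  exact ⟨(h z).summable, rfl⟩

end Main

end HermitianSums

end

theorem theorem1p2 (d : ℕ) (hd : d = 1 ∨ d = 2 ∨ d = 3 ∨ d = 7 ∨ d = 11)
    (Δ : ℕ) (hΔ : 0 < Δ)
    (hnorm : ¬ ∃ b : NumberField.RingOfIntegers (HermitianSums.K d), Algebra.norm ℤ b = (Δ : ℤ)) :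
    -- `k = 1`: the series converges everywhere and `H_{1,Δ}` is constant
    (∀ z : ℂ,
      Summable (fun h : HermitianSums.forms d Δ z => (h : HermitianSums.HermForm d).eval z ^ 1) ∧
      HermitianSums.H d 1 Δ z = HermitianSums.H d 1 Δ 0) ∧
    -- `k = 3`
    (d = 1 ∨ d = 3 ∨ d = 7 → ∀ z : ℂ,
      Summable (fun h : HermitianSums.forms d Δ z => (h : HermitianSums.HermForm d).eval z ^ 3) ∧
      HermitianSums.H d 3 Δ z = HermitianSums.H d 3 Δ 0) ∧
    -- `k = 5`
    (d = 3 → ∀ z : ℂ,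
      Summable (fun h : HermitianSums.forms d Δ z => (h : HermitianSums.HermForm d).eval z ^ 5) ∧
      HermitianSums.H d 5 Δ z = HermitianSums.H d 5 Δ 0) ∧
    -- the constant `α_{k,Δ} = H_{k,Δ}(0)` as a finite divisor sum
    {b : NumberField.RingOfIntegers (HermitianSums.K d) |
      Algebra.norm ℤ b < (Δ : ℤ)}.Finite ∧
    ∀ k : ℕ, Odd k →
      HermitianSums.H d k Δ 0 =
        ∑ᶠ (b : NumberField.RingOfIntegers (HermitianSums.K d))
          (_ : Algebra.norm ℤ b < (Δ : ℤ)),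
          (ArithmeticFunction.sigma k ((Δ : ℤ) - Algebra.norm ℤ b).toNat : ℝ) := by
  have hd0 := HermitianSums.pos_of_mem hd
  refine ⟨HermitianSums.summable_and_H_eq hd odd_one hnorm (HermitianSums.period_one hd0 Δ),
    fun hd' => HermitianSums.summable_and_H_eq hd (by decide) hnorm
      (HermitianSums.period_three_eq hd hd' hnorm), ?_, HermitianSums.finite_norm_lt hd0 Δ,
    fun k hk => ?_⟩
  · rintro rfl
    exact HermitianSums.summable_and_H_eq hd (by decide) hnorm
      (HermitianSums.period_five_eq hd hnorm)
  · rw [HermitianSums.H_eq_tsum hk.pos.ne',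
      (HermitianSums.hasSum_term_zero hd0 hk.pos.ne' Δ).tsum_eq, HermitianSums.sum_edge_eq]
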